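/- All graphs are finite, simple and undirected, and $A(G)$ denotes the adjacency matrix of $G$. For vertices $x,y$ of $G$, we say that $G$ has perfect state transfer (PST) between $x$ and $y$ at time $t>0$ if $\exp(-itA(G))e_x=c\,e_y$ for some $c\in\mathbb{C}$ with $|c|=1$, and that $G$ has pretty good state transfer (PGST) between $x$ and $y$ if for every $\epsilon>0$ there is a time $t>0$ with $|e_y^{T}\exp(-itA(G))e_x|>1-\epsilon$. The eigenvalue support $\mathrm{supp}_G(x)$ is the set of eigenvalues $\lambda$ of $A(G)$ with $f_\lambda e_x\neq 0$, where $f_\lambda$ is the orthogonal projection onto the eigenspace of $\lambda$. The neighborhood corona $G_1\bigstar G_2$ has vertex set $V(G_1)\times(\{0\}\cup V(G_2))$ (where $0\notin V(G_2)$), and $(u,w)$ is adjacent to $(u',w')$ if and only if either $w=w'=0$ and $uu'\in E(G_1)$, or $u=u'$ and $ww'\in E(G_2)$, or $uu'\in E(G_1)$ and exactly one of $w,w'$ is $0$. **Theorem 5.1.** Let $G_1$ be a graph, let $x,y\in V(G_1)$, and let $n_2\ge 0$ be an integer. Let $\lambda_0$ be the largest eigenvalue of $A(G_1)$, and let $g$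 be as in Coutinho's characterization of PST: there are a square-free positive integer $\Delta$ and an integer $a$ such that every $\lambda\in\mathrm{supp}_{G_1}(x)$ has the form $\lambda=\frac12(a+b_\lambda\sqrt{\Delta})$ with $b_\lambda\in\mathbb{Z}$, the numbers $(\lambda_0-\lambda)/\sqrt{\Delta}$ with $\lambda\in\mathrm{supp}_{G_1}(x)$ are integers, and $$g=\gcd\left(\left\{\frac{\lambda_0-\lambda}{\sqrt{\Delta}}:\lambda\in\mathrm{supp}_{G_1}(x)\right\}\right).$$ Suppose that $G_1$ has PST between $x$ and $y$ at time $\pi/g$. If $\sqrt{4n_2+1}$ is not an integer, then $G_1\bigstar\overline{K_{n_2}}$ has PGST between $(x,0)$ and $(y,0)$. -/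

import Mathlib

/-- The transition matrix `exp(-itA(G))` of the continuous-time quantum walk on `G`
relative to the adjacency matrix. -/
noncomputable def transitionMatrix {V : Type*} [Fintype V] [DecidableEq V]
    (G : SimpleGraph V) (t : ℝ) : Matrix V V ℂ :=
  open scoped Classical in
  NormedSpace.exp ((-(Complex.I * (t : ℂ))) • G.adjMatrix ℂ)

/-- `G` admits perfect state transfer between `x` and `y` at time `t > 0`:
`exp(-itA(G)) e_x = c e_y` for some `c` of modulus one. -/
def HasPST {V : Type*} [Fintype V] [DecidableEq V]
    (G : SimpleGraph V) (x y : V) (t : ℝ) : Prop :=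
  0 < t ∧ ∃ c : ℂ, ‖c‖ = 1 ∧
    (transitionMatrix G t).mulVec (Pi.single x 1) = c • (Pi.single y 1 : V → ℂ)

/-- `G` admits pretty good state transfer between `x` and `y`: for every `ε > 0` there is a
time `t > 0` with `|e_yᵀ exp(-itA(G)) e_x| > 1 - ε`. -/
def HasPGST {V : Type*} [Fintype V] [DecidableEq V]
    (G : SimpleGraph V) (x y : V) : Prop :=
  ∀ ε : ℝ, 0 < ε → ∃ t : ℝ, 0 < t ∧ 1 - ε < ‖transitionMatrix G t y x‖

/-- The adjacency matrix of `G` as an operator on Euclidean space. -/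
noncomputable def adjOperator {V : Type*} [Fintype V] [DecidableEq V]
    (G : SimpleGraph V) : Module.End ℝ (EuclideanSpace ℝ V) :=
  open scoped Classical in
  Matrix.toEuclideanLin (G.adjMatrix ℝ)

/-- The eigenvalue support of `x`: the eigenvalues `l` of `A(G)` with `f_l e_x ≠ 0`, where `f_l`
is the orthogonal projection onto the eigenspace of `l`. (If `l` is not an eigenvalue, then the
eigenspace, and so the projection, is zero.) -/
def eigenvalueSupport {V : Type*} [Fintype V] [DecidableEq V]
    (G : SimpleGraph V) (x : V) : Set ℝ :=
  {l | (Module.End.eigenspace (adjOperator G) l).starProjection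
      (EuclideanSpace.single x (1 : ℝ)) ≠ 0}

/-- `g` is the greatest common divisor of a set `S` of real numbers, all of which are integers
(`g = 0` exactly when all elements of `S` are zero). -/
def IsGcdOfReals (S : Set ℝ) (g : ℕ) : Prop :=
  (∀ s ∈ S, ∃ m : ℤ, s = (m : ℝ) * (g : ℝ)) ∧
    ∀ d : ℕ, (∀ s ∈ S, ∃ m : ℤ, s = (m : ℝ) * (d : ℝ)) → d ∣ g

/-- `g` is the integer attached to the vertex `x` in Coutinho's characterization of perfect state
transfer: the elements of the eigenvalue support of `x` are `(a + b_l √Δ) / 2` with `Δ` a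
square-free positive integer and `a`, `b_l` integers, and
`g = gcd {(l₀ - l) / √Δ : l in the support of x}`, where `l₀` is the largest eigenvalue
of `G`. -/
def IsCoutinhoGcd {V : Type*} [Fintype V] [DecidableEq V]
    (G : SimpleGraph V) (x : V) (g : ℕ) : Prop :=
  ∃ (Δ : ℕ) (l₀ : ℝ), Squarefree Δ ∧
    IsGreatest {l : ℝ | Module.End.HasEigenvalue (adjOperator G) l} l₀ ∧
    (∃ a : ℤ, ∀ l ∈ eigenvalueSupport G x, ∃ b : ℤ,
      l = ((a : ℝ) + (b : ℝ) * Real.sqrt (Δ : ℝ)) / 2) ∧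
    IsGcdOfReals ((fun l : ℝ => (l₀ - l) / Real.sqrt (Δ : ℝ)) '' eigenvalueSupport G x) g

/-- The neighborhood corona of `G₁` and `G₂`, on the vertex set `V(G₁) × ({0} ∪ V(G₂))`; the
symbol `0` is `none`. -/
def neighborhoodCorona {V W : Type*} (G₁ : SimpleGraph V) (G₂ : SimpleGraph W) :
    SimpleGraph (V × Option W) where
  Adj p q :=
    (p.2 = none ∧ q.2 = none ∧ G₁.Adj p.1 q.1) ∨
    (p.1 = q.1 ∧ ∃ w w' : W, p.2 = some w ∧ q.2 = some w' ∧ G₂.Adj w w') ∨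
    (G₁.Adj p.1 q.1 ∧ Xor (p.2 = none) (q.2 = none))
  symm := ⟨by
    rintro p q (⟨h₁, h₂, h⟩ | ⟨h, w, w', h₁, h₂, hw⟩ | ⟨h, hx⟩)
    · exact Or.inl ⟨h₂, h₁, h.symm⟩
    · exact Or.inr (Or.inl ⟨h.symm, w', w, h₂, h₁, hw.symm⟩)
    · exact Or.inr (Or.inr ⟨h.symm, hx.symm⟩)⟩
  loopless := ⟨by
    rintro p (⟨_, _, h⟩ | ⟨_, w, w', h₁, h₂, hw⟩ | ⟨h, _⟩)
    · exact G₁.loopless.irrefl _ h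
    · rw [h₁] at h₂
      cases h₂
      exact G₂.loopless.irrefl _ hw
    · exact G₁.loopless.irrefl _ h⟩

/-! The adjacency matrix of the corona is `A ⊗ B`, where `A` is that of `G₁` and `B` is that of the
star `K_{1,n}` with a loop at its center. On the vectors constant on the leaves, `B` has eigenvalues
`μ = (1 ± s) / 2`, the roots of `μ² = μ + n`, with `s = √(4n + 1)`. Hence the walk on the corona
between center copies mixes the walks on `G₁` at times `t(1 + s)/2` and `t(1 - s)/2`, with weights
adding up to 1 (`transitionMatrix_neighborhoodCorona_compl_top`). Perfect state transfer at `τ =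
π/g` forces the support of `x` to consist of half-integers (`eigenvalueSupport_half_int`), so only
times modulo `4π` matter. For `t = 2(τ + 4πl)` the two times are `τ ± θ` modulo `4π`, where `θ` is
`sτ + 4πls` reduced modulo `4π`. As `s` is irrational, Kronecker approximation makes `θ` arbitrarily
small, and continuity brings the entry close to the one of `G₁` at time `τ`, of modulus 1. -/

/-! ### Quantum walks and eigenvectors -/

open Matrix in
open scoped Matrix.Norms.Operator in
/-- A matrix exponential acts on an eigenvector through the exponential of the eigenvalue. -/
theorem Matrix.exp_mulVec_of_mulVec_eq_smul {W : Type*} [Fintype W] [DecidableEq W]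
    {A : Matrix W W ℂ} {z : W → ℂ} {ν : ℂ} (h : A *ᵥ z = ν • z) :
    NormedSpace.exp A *ᵥ z = Complex.exp ν • z := by
  have hpow : ∀ n : ℕ, (A ^ n) *ᵥ z = ν ^ n • z := by
    intro n
    induction n with
    | zero => simp
    | succ n ih => rw [pow_succ, ← mulVec_mulVec, h, mulVec_smul, ih, smul_smul, pow_succ']
  let T : Matrix W W ℂ →+ (W → ℂ) :=
    { toFun := fun X => X *ᵥ z, map_zero' := zero_mulVec z, map_add' := fun X Y => add_mulVec X Y z }
  have hT : Continuous T := by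
    change Continuous fun X : Matrix W W ℂ => X *ᵥ z
    fun_prop
  have h1 := (NormedSpace.exp_series_hasSum_exp' (𝕂 := ℂ) A).map T hT
  have h2 := (NormedSpace.exp_series_hasSum_exp' (𝕂 := ℂ) ν).smul_const z
  rw [← Complex.exp_eq_exp_ℂ] at h2
  refine h1.unique ?_
  convert h2 using 2 with n
  change ((n.factorial : ℂ)⁻¹ • A ^ n) *ᵥ z = _
  rw [smul_mulVec, hpow, smul_assoc]

open Matrix in
theorem transitionMatrix_mulVec {V : Type*} [Fintype V] [DecidableEq V] (G : SimpleGraph V)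
    [DecidableRel G.Adj] (t : ℝ) {z : V → ℂ} {l : ℝ}
    (h : G.adjMatrix ℂ *ᵥ z = (l : ℂ) • z) :
    transitionMatrix G t *ᵥ z = Complex.exp (-(Complex.I * l) * t) • z := by
  unfold transitionMatrix
  apply Matrix.exp_mulVec_of_mulVec_eq_smul
  rw [smul_mulVec]
  convert congrArg (fun w => (-(Complex.I * (t : ℂ))) • w) h using 1
  · congr!
  · rw [smul_smul]
    congr 1
    ring

-- Symmetry passes from the adjacency matrix to its exponential; in a pairing this moves the walk
-- onto an eigenvector.
open Matrix in
theorem transitionMatrix_transpose {V : Type*} [Fintype V] [DecidableEq V] (G : SimpleGraph V)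
    (t : ℝ) : (transitionMatrix G t)ᵀ = transitionMatrix G t := by
  unfold transitionMatrix
  rw [← exp_transpose, transpose_smul, SimpleGraph.transpose_adjMatrix]

open Matrix in
theorem SimpleGraph.adjMatrix_mulVec_ofReal {V : Type*} [Fintype V] (G : SimpleGraph V)
    [DecidableRel G.Adj] {v : V → ℝ} {l : ℝ} (h : G.adjMatrix ℝ *ᵥ v = l • v) :
    (G.adjMatrix ℂ *ᵥ fun u => (v u : ℂ)) = (l : ℂ) • fun u => (v u : ℂ) := by
  ext u
  have := congrFun h u
  simp only [SimpleGraph.adjMatrix_mulVec_apply, Pi.smul_apply, smul_eq_mul] at this ⊢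
  exact_mod_cast congrArg (fun r : ℝ => (r : ℂ)) this

open Matrix in
/-- Perfect state transfer relates the two entries of every eigenvector by a phase. -/
theorem HasPST.eigenvector_phase {V : Type*} [Fintype V] [DecidableEq V] {G : SimpleGraph V}
    [DecidableRel G.Adj] {x y : V} {t : ℝ} (hP : HasPST G x y t) :
    ∃ c : ℂ, ‖c‖ = 1 ∧ transitionMatrix G t y x = c ∧
      ∀ (v : V → ℝ) (l : ℝ), G.adjMatrix ℝ *ᵥ v = l • v →
        Complex.exp (-(Complex.I * l) * t) * v x = c * v y := by
  obtain ⟨-, c, hc, h⟩ := hP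
  refine ⟨c, hc, ?_, fun v l hv => ?_⟩
  · have := congrFun h y
    simpa using this
  · have h1 := transitionMatrix_mulVec G t (G.adjMatrix_mulVec_ofReal hv)
    have h2 : (fun u => (v u : ℂ)) ⬝ᵥ (transitionMatrix G t *ᵥ Pi.single x 1) =
        (fun u => (v u : ℂ)) ⬝ᵥ (c • (Pi.single y 1 : V → ℂ)) := by rw [h]
    rw [dotProduct_mulVec, ← mulVec_transpose, transitionMatrix_transpose, h1] at h2
    simpa using h2

-- The projection of `e_x` vanishes exactly when `e_x` is orthogonal to the eigenspace, and pairing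
-- with `e_x` reads off the entry at `x`.
open Matrix in
theorem mem_eigenvalueSupport_iff {V : Type*} [Fintype V] [DecidableEq V] (G : SimpleGraph V)
    [DecidableRel G.Adj] (x : V) (l : ℝ) :
    l ∈ eigenvalueSupport G x ↔ ∃ v : V → ℝ, G.adjMatrix ℝ *ᵥ v = l • v ∧ v x ≠ 0 := by
  have key : ∀ w : EuclideanSpace ℝ V, w ∈ Module.End.eigenspace (adjOperator G) l ↔
      G.adjMatrix ℝ *ᵥ w.ofLp = l • w.ofLp := by
    intro w
    rw [Module.End.mem_eigenspace_iff, ← (WithLp.ofLp_injective 2).eq_iff]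
    unfold adjOperator
    rw [ofLp_toLpLin, toLin'_apply, WithLp.ofLp_smul]
    congr!
  unfold eigenvalueSupport
  rw [Set.mem_ofPred_eq, Ne, Submodule.starProjection_apply_eq_zero_iff,
    Submodule.mem_orthogonal]
  push Not
  constructor
  · rintro ⟨w, hw, h⟩
    refine ⟨w.ofLp, (key w).1 hw, ?_⟩
    simpa [EuclideanSpace.inner_single_right] using h
  · rintro ⟨v, hv, h⟩
    refine ⟨WithLp.toLp 2 v, (key _).2 hv, ?_⟩
    simpa [EuclideanSpace.inner_single_right] using h

/-! ### Phases, irrationality and approximation -/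

/-- For real numbers `r`, `r'` with `e^{-irt} a = c b`, `e^{-ir't} a' = c b'`, `a a' ≠ 0`, the
difference `(r - r') t` is a multiple of `π`. -/
theorem exists_int_mul_pi_of_phase {c : ℂ} (hc : ‖c‖ = 1) {r r' t a b a' b' : ℝ}
    (h : Complex.exp (-(Complex.I * r) * t) * a = c * b)
    (h' : Complex.exp (-(Complex.I * r') * t) * a' = c * b') (ha : a ≠ 0) (ha' : a' ≠ 0) :
    ∃ k : ℤ, (r - r') * t = k * Real.pi := by
  have hE : Complex.exp (((r - r') * t : ℝ) * Complex.I) *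
      Complex.exp (-(Complex.I * r) * t) = Complex.exp (-(Complex.I * r') * t) := by
    rw [← Complex.exp_add]; congr 1; push_cast; ring
  have hc0 : c ≠ 0 := by rintro rfl; simp at hc
  -- Eliminating `c` leaves a unit complex number that carries a nonzero real number to a real one,
  -- so its imaginary part, a sine, is zero.
  have hb : Complex.exp (((r - r') * t : ℝ) * Complex.I) * (b * a' : ℝ) = (b' * a : ℝ) := by
    apply mul_left_cancel₀ hc0
    push_cast
    calc _ = Complex.exp (((r - r') * t : ℝ) * Complex.I) * (c * b) * a' := by push_cast; ring
      _ = (Complex.exp (((r - r') * t : ℝ) * Complex.I) *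
          Complex.exp (-(Complex.I * r) * t)) * a' * a := by rw [← h]; ring
      _ = c * (b' * a) := by rw [hE, h']; ring
  have hb0 : b ≠ 0 := by
    rintro rfl
    simp [ha] at h
  have him := congrArg Complex.im hb
  rw [Complex.im_mul_ofReal, Complex.exp_ofReal_mul_I_im, Complex.ofReal_im] at him
  have := (mul_eq_zero.1 him).resolve_right (mul_ne_zero hb0 ha')
  obtain ⟨k, hk⟩ := Real.sin_eq_zero_iff.1 this
  exact ⟨k, hk.symm⟩

theorem Squarefree.eq_one_of_sqrt_mul_int {Δ : ℕ} (hΔ : Squarefree Δ) {m k : ℤ} (hm : m ≠ 0)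
    (h : Real.sqrt Δ * m = k) : Δ = 1 := by
  have hirr : ¬ Irrational (Real.sqrt Δ) := by
    intro hi
    exact (hi.mul_intCast hm).ne_int k h
  rw [irrational_sqrt_natCast_iff, not_not] at hirr
  obtain ⟨r, rfl⟩ := hirr
  have := hΔ r dvd_rfl
  simp [Nat.isUnit_iff.1 this]

theorem four_mul_add_one_irrational {n : ℕ}
    (hn : ¬ ∃ m : ℤ, Real.sqrt (4 * (n : ℝ) + 1) = (m : ℝ)) :
    Irrational (Real.sqrt (4 * (n : ℝ) + 1)) := by
  have : (4 * (n : ℝ) + 1) = ((4 * n + 1 : ℕ) : ℝ) := by push_cast; ring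
  rw [this] at hn ⊢
  rw [irrational_sqrt_natCast_iff]
  rintro ⟨r, hr⟩
  refine hn ⟨r, ?_⟩
  rw [hr, Nat.cast_mul, Real.sqrt_mul_self (Nat.cast_nonneg r)]
  simp

/-- Inhomogeneous Kronecker approximation in one dimension, with a nonnegative multiplier. -/
theorem Irrational.exists_nat_int_abs_lt {s : ℝ} (hs : Irrational s) {p : ℝ} (hp : 0 < p) (r : ℝ)
    {δ : ℝ} (hδ : 0 < δ) : ∃ (l : ℕ) (k : ℤ), |r + l * (p * s) - k * p| < δ := by
  have : Fact (0 < p) := ⟨hp⟩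
  have h1 : DenseRange (fun n : ℤ => n • ((p * s : ℝ) : AddCircle p)) := by
    rw [AddCircle.denseRange_zsmul_coe_iff, mul_div_cancel_left₀ _ hp.ne']
    exact hs
  -- Nonnegative multipliers suffice for density in the circle; they keep the final time positive.
  have h2 := denseRange_zsmul_iff_nsmul.1 h1
  obtain ⟨l, hl⟩ := h2.exists_dist_lt (-((r : ℝ) : AddCircle p)) hδ
  refine ⟨l, round (p⁻¹ * (r + l * (p * s))), ?_⟩
  rw [← AddCircle.norm_eq]
  rw [dist_eq_norm, ← norm_neg] at hl
  have h3 : ((r + l * (p * s) : ℝ) : AddCircle p) =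
      -(-((r : ℝ) : AddCircle p) - l • ((p * s : ℝ) : AddCircle p)) := by
    rw [← nsmul_eq_mul, AddCircle.coe_add, AddCircle.coe_nsmul]
    abel
  rw [h3]
  exact hl

theorem Complex.exp_half_int_period {l : ℝ} {b : ℤ} (hl : l = b / 2) (a : ℝ) (k : ℤ) :
    Complex.exp (-(Complex.I * l) * (a + k * (4 * Real.pi) : ℝ)) =
      Complex.exp (-(Complex.I * l) * a) := by
  rw [Complex.exp_eq_exp_iff_exists_int]
  refine ⟨-(b * k), ?_⟩
  rw [hl]
  push_cast
  ring

/-! ### Spectral decomposition of the corona walk -/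

open Matrix in
/-- An eigenvector of `G` and an eigenvector `(μ, 1, …, 1)` of the star `K_{1,n}` with a loop at its
center give an eigenvector of the neighborhood corona of `G` and the empty graph. -/
theorem neighborhoodCorona_compl_top_mulVec {V : Type*} [Fintype V] [DecidableEq V]
    (G : SimpleGraph V) [DecidableRel G.Adj] (n : ℕ)
    [DecidableRel (neighborhoodCorona G (⊤ : SimpleGraph (Fin n))ᶜ).Adj]
    {v : V → ℝ} {l μ : ℝ} (hv : G.adjMatrix ℝ *ᵥ v = l • v) (hμ : μ ^ 2 = μ + n) :
    (neighborhoodCorona G (⊤ : SimpleGraph (Fin n))ᶜ).adjMatrix ℝ *ᵥ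
        (fun p => v p.1 * p.2.elim μ fun _ => 1) =
      (l * μ) • fun p => v p.1 * p.2.elim μ fun _ => 1 := by
  have hsum : ∀ u, ∑ w, (if G.Adj u w then (1 : ℝ) else 0) * v w = l * v u := by
    intro u
    simpa [mulVec, dotProduct, SimpleGraph.adjMatrix_apply] using congrFun hv u
  ext ⟨u, o⟩
  have hadj : ∀ p q, (neighborhoodCorona G (⊤ : SimpleGraph (Fin n))ᶜ).Adj p q ↔
      G.Adj p.1 q.1 ∧ (p.2 = none ∨ q.2 = none) := by
    rintro ⟨a, i⟩ ⟨b, j⟩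
    cases i <;> cases j <;> simp [neighborhoodCorona, Xor]
  simp only [mulVec, dotProduct, SimpleGraph.adjMatrix_apply, Fintype.sum_prod_type,
    Fintype.sum_option, hadj, Pi.smul_apply, smul_eq_mul]
  cases o with
  | none =>
    simp only [true_or, and_true, Option.elim_none, Option.elim_some, mul_one,
      Finset.sum_const, Finset.card_univ, Fintype.card_fin, nsmul_eq_mul]
    calc _ = ∑ w, (μ + n) * ((if G.Adj u w then (1 : ℝ) else 0) * v w) :=
          Finset.sum_congr rfl fun w _ => by ring
      _ = l * μ * (v u * μ) := by rw [← Finset.mul_sum, hsum, ← hμ]; ring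
  | some i =>
    simp only [reduceCtorEq, or_true, and_true, or_self, and_false, if_false, zero_mul,
      Finset.sum_const_zero, add_zero, Option.elim_none, Option.elim_some, mul_one]
    calc _ = ∑ w, μ * ((if G.Adj u w then (1 : ℝ) else 0) * v w) :=
          Finset.sum_congr rfl fun w _ => by ring
      _ = l * μ * v u := by rw [← Finset.mul_sum, hsum]; ring

/-- The real eigenvectors of an orthonormal eigenbasis resolve the identity. -/
theorem Matrix.IsHermitian.sum_eigenvectorBasis_mul {V : Type*} [Fintype V] [DecidableEq V]
    {A : Matrix V V ℝ} (hA : A.IsHermitian) (x y : V) :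
    ∑ j, hA.eigenvectorBasis j x * hA.eigenvectorBasis j y = if y = x then 1 else 0 := by
  have h := congrFun (congrFun (Unitary.coe_mul_star_self hA.eigenvectorUnitary) y) x
  rw [Matrix.mul_apply, Matrix.one_apply] at h
  rw [← h]
  refine Finset.sum_congr rfl fun j _ => ?_
  simp [Matrix.star_apply, mul_comm]

open Matrix in
theorem transitionMatrix_apply_eq_sum {V : Type*} [Fintype V] [DecidableEq V] (G : SimpleGraph V)
    [DecidableRel G.Adj] (hA : (G.adjMatrix ℝ).IsHermitian) (t : ℝ) (x y : V) :
    transitionMatrix G t y x = ∑ j, (hA.eigenvectorBasis j x : ℂ) * hA.eigenvectorBasis j y *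
      Complex.exp (-(Complex.I * hA.eigenvalues j) * t) := by
  have hx : (Pi.single x 1 : V → ℂ) =
      ∑ j, (hA.eigenvectorBasis j x : ℂ) • fun u => (hA.eigenvectorBasis j u : ℂ) := by
    ext u
    have := congrArg (fun r : ℝ => (r : ℂ)) (hA.sum_eigenvectorBasis_mul x u)
    simp only [Finset.sum_apply, Pi.smul_apply, smul_eq_mul, Pi.single_apply]
    rw [apply_ite Complex.ofReal, Complex.ofReal_one, Complex.ofReal_zero] at this
    push_cast at this
    exact this.symm
  have h1 : transitionMatrix G t y x = (transitionMatrix G t *ᵥ Pi.single x 1) y := by simp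
  rw [h1, hx, mulVec_sum, Finset.sum_apply]
  refine Finset.sum_congr rfl fun j _ => ?_
  rw [mulVec_smul, transitionMatrix_mulVec G t
    (G.adjMatrix_mulVec_ofReal (hA.mulVec_eigenvectorBasis j))]
  simp only [Pi.smul_apply, smul_eq_mul]
  ring

open Matrix in
theorem transitionMatrix_neighborhoodCorona_compl_top {V : Type*} [Fintype V] [DecidableEq V]
    (G : SimpleGraph V) [DecidableRel G.Adj] (hA : (G.adjMatrix ℝ).IsHermitian) (n : ℕ)
    {s : ℝ} (hs : s ^ 2 = 4 * n + 1) (hs0 : s ≠ 0) (t : ℝ) (x y : V) :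
    transitionMatrix (neighborhoodCorona G (⊤ : SimpleGraph (Fin n))ᶜ) t (y, none) (x, none) =
      ∑ j, (hA.eigenvectorBasis j x : ℂ) * hA.eigenvectorBasis j y *
        ((1 + s) / (2 * s) * Complex.exp (-(Complex.I * hA.eigenvalues j) * (t * (1 + s) / 2 : ℝ)) -
         (1 - s) / (2 * s) *
          Complex.exp (-(Complex.I * hA.eigenvalues j) * (t * (1 - s) / 2 : ℝ))) := by
  classical
  set H := neighborhoodCorona G (⊤ : SimpleGraph (Fin n))ᶜ with hH
  let w : V → ℝ → V × Option (Fin n) → ℝ :=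
    fun j μ p => hA.eigenvectorBasis j p.1 * p.2.elim μ fun _ => 1
  have hw : ∀ (j : V) (μ : ℝ), μ ^ 2 = μ + n → transitionMatrix H t *ᵥ (fun p => (w j μ p : ℂ)) =
      Complex.exp (-(Complex.I * hA.eigenvalues j) * (t * μ : ℝ)) • fun p => (w j μ p : ℂ) := by
    intro j μ hμ
    have := transitionMatrix_mulVec H t (H.adjMatrix_mulVec_ofReal
      (neighborhoodCorona_compl_top_mulVec G n (hA.mulVec_eigenvectorBasis j) hμ))
    rw [this]
    congr 2
    push_cast
    ring
  have hs' : (s : ℂ) ≠ 0 := by exact_mod_cast hs0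
  -- The difference of `(μ₊, 1, …, 1)` and `(μ₋, 1, …, 1)` is `s` times the center vector, whence
  -- the division by `s`.
  have hx : (Pi.single (x, none) 1 : V × Option (Fin n) → ℂ) =
      ∑ j, ((hA.eigenvectorBasis j x : ℂ) / s) •
        ((fun p => (w j ((1 + s) / 2) p : ℂ)) - fun p => (w j ((1 - s) / 2) p : ℂ)) := by
    ext ⟨u, o⟩
    have := congrArg (fun r : ℝ => (r : ℂ)) (hA.sum_eigenvectorBasis_mul x u)
    rw [apply_ite Complex.ofReal, Complex.ofReal_one, Complex.ofReal_zero] at this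
    push_cast at this
    simp only [Finset.sum_apply, Pi.smul_apply, smul_eq_mul, Pi.single_apply, Pi.sub_apply, w,
      Prod.mk.injEq]
    cases o with
    | none =>
      simp only [and_true, Option.elim_none]
      rw [← this]
      refine Finset.sum_congr rfl fun j _ => ?_
      push_cast
      field_simp
      ring
    | some i => simp
  have h1 : transitionMatrix H t (y, none) (x, none) =
      (transitionMatrix H t *ᵥ Pi.single (x, none) 1) (y, none) := by simp
  rw [h1, hx, mulVec_sum, Finset.sum_apply]
  refine Finset.sum_congr rfl fun j _ => ?_
  rw [mulVec_smul, mulVec_sub, hw j _ (by linear_combination hs / 4),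
    hw j _ (by linear_combination hs / 4), ← mul_div_assoc, ← mul_div_assoc]
  simp only [Pi.smul_apply, Pi.sub_apply, smul_eq_mul, w, Option.elim_none]
  push_cast
  field_simp

/-! ### Integrality of the eigenvalue support -/

open Matrix in
/-- A vertex whose eigenvalue support is a single point has eigenvalue support in `{0}`. -/
theorem eq_zero_of_eigenvalueSupport_subset_singleton {V : Type*} [Fintype V] [DecidableEq V]
    (G : SimpleGraph V) (x : V) {l : ℝ} (h : eigenvalueSupport G x ⊆ {l}) : l = 0 := by
  classical
  have hA : (G.adjMatrix ℝ).IsHermitian := by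
    simp [Matrix.IsHermitian, conjTranspose_eq_transpose_of_trivial]
  have hx : (Pi.single x 1 : V → ℝ) =
      ∑ j, hA.eigenvectorBasis j x • ⇑(hA.eigenvectorBasis j) := by
    ext u
    simpa [Pi.single_apply] using (hA.sum_eigenvectorBasis_mul x u).symm
  have h1 : G.adjMatrix ℝ *ᵥ Pi.single x 1 = l • (Pi.single x 1 : V → ℝ) := by
    rw [hx, mulVec_sum, Finset.smul_sum]
    refine Finset.sum_congr rfl fun j _ => ?_
    rw [mulVec_smul, hA.mulVec_eigenvectorBasis]
    by_cases hj : hA.eigenvectorBasis j x = 0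
    · simp [hj]
    · have : hA.eigenvalues j = l := h ((mem_eigenvalueSupport_iff G x _).2
        ⟨_, hA.mulVec_eigenvectorBasis j, hj⟩)
      rw [this, smul_comm]
  -- Now `e_x` is itself an eigenvector, and the diagonal entry of the adjacency matrix at `x` is
  -- zero.
  simpa using (congrFun h1 x).symm

/-- Under perfect state transfer at time `π / g`, the eigenvalue support consists of
half-integers. -/
theorem eigenvalueSupport_half_int {V : Type*} [Fintype V] [DecidableEq V] {G : SimpleGraph V}
    {x y : V} {g : ℕ} (hg : IsCoutinhoGcd G x g) (hP : HasPST G x y (Real.pi / (g : ℝ)))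
    {l : ℝ} (hl : l ∈ eigenvalueSupport G x) : ∃ b : ℤ, l = b / 2 := by
  classical
  by_cases hsub : eigenvalueSupport G x ⊆ {l}
  · exact ⟨0, by simp [eq_zero_of_eigenvalueSupport_subset_singleton G x hsub]⟩
  obtain ⟨l', hl', hne⟩ := Set.not_subset.1 hsub
  rw [Set.mem_singleton_iff] at hne
  obtain ⟨Δ, l₀, hΔ, -, ⟨a, ha⟩, hgcd, -⟩ := hg
  -- For `g = 0` the time `π / g` would be 0 by convention, but transfer times are positive.
  have hg0 : (g : ℝ) ≠ 0 := by
    intro h0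
    have := hP.1
    simp [h0] at this
  have hΔ0 : Real.sqrt Δ ≠ 0 :=
    (Real.sqrt_pos.2 (by exact_mod_cast Nat.pos_of_ne_zero hΔ.ne_zero)).ne'
  obtain ⟨m, hm⟩ := hgcd _ ⟨l, hl, rfl⟩
  obtain ⟨m', hm'⟩ := hgcd _ ⟨l', hl', rfl⟩
  obtain ⟨c, hc, -, hph⟩ := hP.eigenvector_phase
  obtain ⟨v, hv, hvx⟩ := (mem_eigenvalueSupport_iff G x l).1 hl
  obtain ⟨v', hv', hvx'⟩ := (mem_eigenvalueSupport_iff G x l').1 hl'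
  obtain ⟨k, hk⟩ := exists_int_mul_pi_of_phase hc (hph v l hv) (hph v' l' hv') hvx hvx'
  have hdiff : l - l' = Real.sqrt Δ * (m' - m) * g := by
    simp only at hm hm'
    rw [div_eq_iff hΔ0] at hm hm'
    linear_combination hm' - hm
  -- The phase condition at time `π / g` makes a nonzero integer multiple of `√Δ` an integer, hence
  -- `Δ = 1`.
  have hk' : Real.sqrt Δ * ((m' - m : ℤ) : ℝ) = k := by
    apply mul_right_cancel₀ Real.pi_ne_zero
    rw [← hk, hdiff]
    push_cast
    field_simp
  have hmm : m' - m ≠ 0 := by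
    intro h0
    apply hne
    have : (m' : ℝ) - m = 0 := by exact_mod_cast h0
    rw [this] at hdiff
    linarith
  have h1 := hΔ.eq_one_of_sqrt_mul_int hmm hk'
  obtain ⟨b, hb⟩ := ha l hl
  refine ⟨a + b, ?_⟩
  rw [hb, h1]
  simp

theorem theorem5p1 {V : Type*} [Fintype V] [DecidableEq V] (G₁ : SimpleGraph V) (x y : V)
    (g n₂ : ℕ) (hg : IsCoutinhoGcd G₁ x g) (hPST : HasPST G₁ x y (Real.pi / (g : ℝ)))
    (hn₂ : ¬ ∃ m : ℤ, Real.sqrt (4 * (n₂ : ℝ) + 1) = (m : ℝ)) :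
    HasPGST (neighborhoodCorona G₁ (⊤ : SimpleGraph (Fin n₂))ᶜ) (x, none) (y, none) := by
  classical
  intro ε hε
  have hirr := four_mul_add_one_irrational hn₂
  set s := Real.sqrt (4 * (n₂ : ℝ) + 1) with hsdef
  have hs : s ^ 2 = 4 * n₂ + 1 := Real.sq_sqrt (by positivity)
  have hs0 : s ≠ 0 := hirr.ne_zero
  have hsC : (s : ℂ) ≠ 0 := by exact_mod_cast hs0
  set τ := Real.pi / (g : ℝ) with hτ
  have hτ0 : 0 < τ := hPST.1
  have hA : (G₁.adjMatrix ℝ).IsHermitian := by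
    simp [Matrix.IsHermitian, Matrix.conjTranspose_eq_transpose_of_trivial]
  -- `F θ` is the corona entry with the two times replaced by `τ + θ` and `τ - θ`; at `θ = 0` the
  -- weights add up to 1.
  let F : ℝ → ℂ := fun θ => ∑ j, (hA.eigenvectorBasis j x : ℂ) * hA.eigenvectorBasis j y *
        ((1 + s) / (2 * s) * Complex.exp (-(Complex.I * hA.eigenvalues j) * (τ + θ : ℝ)) -
         (1 - s) / (2 * s) * Complex.exp (-(Complex.I * hA.eigenvalues j) * (τ - θ : ℝ)))
  have hFc : Continuous F := by fun_prop
  have hF0 : ‖F 0‖ = 1 := by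
    obtain ⟨c, hc, hcU, -⟩ := hPST.eigenvector_phase
    rw [← hc, ← hcU, transitionMatrix_apply_eq_sum G₁ hA]
    congr 1
    refine Finset.sum_congr rfl fun j _ => ?_
    rw [add_zero, sub_zero, ← sub_mul]
    have : (1 + s : ℂ) / (2 * s) - (1 - s) / (2 * s) = 1 := by field_simp; ring
    rw [this, one_mul]
  have hnear : ∀ᶠ θ in nhds (0 : ℝ), 1 - ε < ‖F θ‖ :=
    (hFc.norm.tendsto 0).eventually (lt_mem_nhds (by rw [hF0]; linarith))
  obtain ⟨δ, hδ, hball⟩ := Metric.eventually_nhds_iff.1 hnear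
  have h4π : 0 < 4 * Real.pi := by positivity
  obtain ⟨l, k, hlk⟩ := hirr.exists_nat_int_abs_lt h4π (s * τ) hδ
  refine ⟨2 * (τ + l * (4 * Real.pi)), by positivity, ?_⟩
  set θ := s * τ + l * (4 * Real.pi * s) - k * (4 * Real.pi) with hθ
  have hmain := @hball θ (by simpa [Real.dist_eq] using hlk)
  rw [transitionMatrix_neighborhoodCorona_compl_top G₁ hA n₂ hs hs0]
  convert hmain using 2
  refine Finset.sum_congr rfl fun j _ => ?_
  -- Only eigenvalues in the support of `x` are known to be half-integers; the other terms have
  -- coefficient zero.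
  by_cases hj : hA.eigenvectorBasis j x = 0
  · simp [hj]
  obtain ⟨b, hb⟩ := eigenvalueSupport_half_int hg hPST
    ((mem_eigenvalueSupport_iff G₁ x _).2 ⟨_, hA.mulVec_eigenvectorBasis j, hj⟩)
  have e1 : 2 * (τ + l * (4 * Real.pi)) * (1 + s) / 2 =
      τ + θ + ((l + k : ℤ) : ℝ) * (4 * Real.pi) := by rw [hθ]; push_cast; ring
  have e2 : 2 * (τ + l * (4 * Real.pi)) * (1 - s) / 2 =
      τ - θ + ((l - k : ℤ) : ℝ) * (4 * Real.pi) := by rw [hθ]; push_cast; ring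
  rw [e1, e2, Complex.exp_half_int_period hb, Complex.exp_half_int_period hb]
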